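/- All graphs are finite, simple and undirected. For a connected (in particular non-empty) graph $G$ and a path $P$ in $G$, the eccentricity of $P$ is $\max_{x\in V(G)}\min_{y\in V(P)} \mathrm{dist}_G(x,y)$, and the path eccentricity $\mathrm{pe}(G)$ is the minimum eccentricity of a path in $G$. A graph $G$ is $H$-free if no induced subgraph of $G$ is isomorphic to $H$. Let $P_n$ denote the path with $n$ vertices ($P_0$ being the graph with no vertices), let $+$ denote disjoint union, and let $3P_k = P_k+P_k+P_k$. Let $H$ be a graph and let $k\ge 1$ be an integer. Then the following statements are equivalent: (i) every connected $H$-free graph $G$ satisfies $\mathrm{pe}(G)<k$; (ii) $H$ is isomorphic to an induced subgraph of $3P_k$ or to an induced subgraph of $P_{2k+1}+P_{k-1}$. -/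

import Mathlib

namespace SimpleGraph

/-- The eccentricity of a walk `p` in `G`: the maximum, over all vertices `x` of `G`, of the
distance from `x` to a nearest vertex of `p`. -/
noncomputable def walkEccentricity {V : Type*} (G : SimpleGraph V) {u v : V}
    (p : G.Walk u v) : ℕ∞ :=
  ⨆ x : V, ⨅ y ∈ p.support, G.edist x y

/-- The path eccentricity of `G`: the minimum eccentricity of a path in `G`. -/
noncomputable def pathEccentricity {V : Type*} (G : SimpleGraph V) : ℕ∞ :=
  ⨅ (u : V) (v : V) (p : G.Walk u v) (_ : p.IsPath), G.walkEccentricity p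

/-- `G` is `H`-free: no induced subgraph of `G` is isomorphic to `H`. -/
def IsIndFree {V W : Type*} (H : SimpleGraph W) (G : SimpleGraph V) : Prop :=
  ¬ H.IsIndContained G

end SimpleGraph

universe u v

/-! If no path comes within distance `k - 1` of every vertex, choose a path `L` covering an
inclusion-maximal set and shortest as such, and a vertex `x` it misses. By minimality each end of
`L` has a private vertex: `y` is close to `p` only, `z` to `e` only. Geodesics `A` from `y` to `p`,
`B` from `z` to `e`, and `Q` to `x` from the vertex `c` of `L` nearest to `x`, with `c` removed, are
pairwise apart: any contact would let `L` be rerouted to a path that contains it and also `x`. They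
yield `3P_k`. A shortest `y`-`z` path inside `A ∪ L ∪ B`, together with the part of `Q` at distance
at least 2 from `L`, yields `P_{2k+1} + P_{k-1}` (`exists_apart_geodesics`,
`isIndContained_of_forall_not_covers`).

Conversely, the spider and the net have path eccentricity at least `k`
(`le_pathEccentricity_of_depth`), so `H` embeds in both. A copy in the spider avoiding the centre
lies in `3P_k`. A copy using the centre misses one of its neighbours, since the net has no induced
claw, and so lies in `P_{2k+1} + P_{k-1}`. -/

namespace SimpleGraph

variable {V : Type*} {G : SimpleGraph V}

/-! ### Separated walks and induced paths -/

/-- No vertex of `p` is equal or adjacent to a vertex of `q`. -/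
def Walk.Apart {a b c d : V} (p : G.Walk a b) (q : G.Walk c d) : Prop :=
  ∀ x ∈ p.support, ∀ y ∈ q.support, x ≠ y ∧ ¬ G.Adj x y

/-- Wherever the two walks touch, one can switch from `p` to `q`, which gives a walk from `a` to `d`
inside their union. -/
theorem Walk.apart_of_forall_not_subset {a b c d : V} (p : G.Walk a b) (q : G.Walk c d)
    (h : ∀ r : G.Walk a d, ¬ ∀ x ∈ r.support, x ∈ p.support ∨ x ∈ q.support) : p.Apart q := by
  classical
  intro x hx y hy
  constructor
  · rintro rfl
    refine h ((p.takeUntil x hx).append (q.dropUntil x hy)) fun v hv => ?_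
    rw [Walk.mem_support_append_iff] at hv
    exact hv.imp (fun h => p.support_takeUntil_subset_support hx h)
      (fun h => q.support_dropUntil_subset_support hy h)
  · intro hadj
    refine h ((p.takeUntil x hx).append (.cons hadj (q.dropUntil y hy))) fun v hv => ?_
    rw [Walk.mem_support_append_iff, Walk.support_cons, List.mem_cons] at hv
    rcases hv with hv | rfl | hv
    · exact .inl (p.support_takeUntil_subset_support hx hv)
    · exact .inl hx
    · exact .inr (q.support_dropUntil_subset_support hy hv)

/-- Consecutive vertices of a geodesic induce a path. -/
theorem Walk.exists_pathGraph_embedding {a b : V} (w : G.Walk a b) (hw : w.length = G.dist a b)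
    {n s : ℕ} (hn : n + s ≤ w.length + 1) :
    ∃ f : pathGraph n ↪g G, ∀ i, f i = w.getVert (s + i) := by
  -- A repetition or a chord would give a shortcut, contradicting that `w` is a geodesic.
  have hne : ∀ i j, i < j → j ≤ w.length → w.getVert i ≠ w.getVert j := by
    intro i j hij hj heq
    have := dist_le ((w.take i).append ((w.drop j).copy heq.symm rfl))
    simp at this
    omega
  have hadj : ∀ i j, i < j → j ≤ w.length → G.Adj (w.getVert i) (w.getVert j) → i + 1 = j := by
    intro i j hij hj h
    have := dist_le ((w.take i).append (.cons h (w.drop j)))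
    simp at this
    omega
  refine ⟨⟨⟨fun i => w.getVert (s + i), ?_⟩, ?_⟩, fun _ => rfl⟩
  · intro i j hij
    by_contra hne'
    rcases lt_or_gt_of_ne (Fin.val_ne_of_ne hne') with h | h
    · exact hne (s + i) (s + j) (by omega) (by omega) hij
    · exact hne (s + j) (s + i) (by omega) (by omega) hij.symm
  · intro i j
    rw [pathGraph_adj]
    constructor
    · intro h
      rcases lt_trichotomy (i : ℕ) j with hij | hij | hij
      · have := hadj (s + i) (s + j) (by omega) (by omega) h
        omega
      · exact absurd (congrArg (fun t => w.getVert (s + t)) hij) h.ne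
      · have := hadj (s + j) (s + i) (by omega) (by omega) h.symm
        omega
    · rintro (h | h)
      · have := w.adj_getVert_succ (i := s + i) (by omega)
        rwa [show s + (i : ℕ) + 1 = s + j by omega] at this
      · have := w.adj_getVert_succ (i := s + j) (by omega)
        rw [show s + (j : ℕ) + 1 = s + i by omega] at this
        exact this.symm

theorem exists_sum_embedding {A B : Type*} {GA : SimpleGraph A} {GB : SimpleGraph B}
    (f : GA ↪g G) (g : GB ↪g G) (h : ∀ a b, f a ≠ g b ∧ ¬ G.Adj (f a) (g b)) :
    ∃ e : (GA ⊕g GB) ↪g G, (∀ a, e (.inl a) = f a) ∧ ∀ b, e (.inr b) = g b := by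
  refine ⟨⟨⟨Sum.elim f g, ?_⟩, ?_⟩, fun _ => Eq.refl _, fun _ => Eq.refl _⟩
  · rintro (a | a) (b | b) hab
    · simpa using hab
    · exact absurd hab (h a b).1
    · exact absurd hab.symm (h b a).1
    · simpa using hab
  · rintro (a | a) (b | b)
    · change G.Adj (f a) (f b) ↔ _; simp
    · change G.Adj (f a) (g b) ↔ _; simpa using (h a b).2
    · change G.Adj (g a) (f b) ↔ _; simpa using fun hab => (h b a).2 hab.symm
    · change G.Adj (g a) (g b) ↔ _; simp

/-! ### Optimal paths and their rerouting -/

/-- `x` is at distance less than `k` from some vertex of the list `l`. -/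
def Covers (G : SimpleGraph V) (k : ℕ) (l : List V) (x : V) : Prop :=
  ∃ y ∈ l, G.dist x y < k

/-- Lists of vertices that are paths. -/
def IsPathList (G : SimpleGraph V) (l : List V) : Prop := l.IsChain G.Adj ∧ l.Nodup

/-- A path that covers an inclusion-maximal set of vertices and is shortest as such. -/
structure IsOptimal (G : SimpleGraph V) (k : ℕ) (l : List V) : Prop where
  isPathList : G.IsPathList l
  covers_of_subset : ∀ l', G.IsPathList l' → l ⊆ l' → ∀ x, G.Covers k l' x → G.Covers k l x
  length_le : ∀ l', G.IsPathList l' → (∀ x, G.Covers k l x → G.Covers k l' x) →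
    l.length ≤ l'.length

theorem exists_isOptimal [Finite V] (G : SimpleGraph V) (k : ℕ) : ∃ l, G.IsOptimal k l := by
  obtain ⟨C, ⟨l₀, hl₀, rfl⟩, hC⟩ := (wellFounded_gt (α := Set V)).has_min
    {C | ∃ l, G.IsPathList l ∧ {x | G.Covers k l x} = C} ⟨_, [], ⟨by simp, by simp⟩, rfl⟩
  obtain ⟨l, ⟨hl, hl'⟩, hmin⟩ := (measure (List.length (α := V))).wf.has_min
    {l | G.IsPathList l ∧ {x | G.Covers k l₀ x} ⊆ {x | G.Covers k l x}} ⟨l₀, hl₀, subset_rfl⟩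
  refine ⟨l, hl, fun l' hl₁ hsub x hx => ?_, fun l' hl₁ hsub => ?_⟩
  · by_contra hxl
    refine hC _ ⟨l', hl₁, rfl⟩ ((Set.ssubset_iff_of_subset ?_).2 ⟨x, hx, fun h => hxl (hl' h)⟩)
    intro v hv
    obtain ⟨y, hy, hvy⟩ := hl' hv
    exact ⟨y, hsub hy, hvy⟩
  · exact not_lt.1 (hmin l' ⟨hl₁, fun v hv => hsub v (hl' hv)⟩)

/-- Being shorter, `l` must lose some covered vertex, and only `p` can have covered it. -/
theorem IsOptimal.exists_private {k : ℕ} {L l : List V} (h : G.IsOptimal k L)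
    (hl : G.IsPathList l) {p : V} (hsub : ∀ x ∈ L, x = p ∨ x ∈ l) (hlen : l.length < L.length) :
    ∃ y, G.dist y p < k ∧ ∀ r ∈ l, k ≤ G.dist y r := by
  by_contra! hcon
  refine hlen.not_ge (h.length_le l hl fun x ⟨r, hr, hxr⟩ => ?_)
  rcases hsub r hr with rfl | hr
  · exact hcon x hxr
  · exact ⟨r, hr, hxr⟩

theorem IsOptimal.not_mem_of_subset {k : ℕ} (hk : 1 ≤ k) {L l : List V} (h : G.IsOptimal k L)
    {x : V} (hx : ¬ G.Covers k L x) (hl : G.IsPathList l) (hsub : L ⊆ l) : x ∉ l := fun hxl =>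
  hx (h.covers_of_subset l hl hsub x ⟨x, hxl, by rw [dist_self]; exact hk⟩)

/-- An optimal path cannot be extended at its start to reach an uncovered vertex. -/
theorem IsOptimal.not_disjoint_of_cons {k : ℕ} (hk : 1 ≤ k) {p : V} {l : List V}
    (h : G.IsOptimal k (p :: l)) {x : V} (hx : ¬ G.Covers k (p :: l) x) (w : G.Walk x p) :
    ¬ ∀ v ∈ w.support, v ∉ l := by
  classical
  intro hw
  have hc := h.isPathList.1
  have hn := h.isPathList.2
  have hs := w.bypass.support_ne_nil
  have hpath := w.bypass_isPath.support_nodup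
  have hlast := w.bypass.getLast_support
  have hsub := w.support_bypass_subset_support
  refine h.not_mem_of_subset hk hx (l := w.bypass.support ++ l) ⟨?_, ?_⟩ ?_
    (List.mem_append_left _ w.bypass.start_mem_support)
  · have e : w.bypass.support = w.bypass.support.dropLast ++ [p] := by
      conv_lhs => rw [← List.dropLast_append_getLast hs, hlast]
    rw [e]
    refine List.IsChain.append_overlap (l₂ := [p]) ?_ hc (by simp)
    rw [← e]
    exact w.bypass.isChain_adj_support
  · refine List.nodup_append.2 ⟨hpath, hn.of_cons, ?_⟩
    rintro a ha b hb rfl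
    exact hw a (hsub ha) hb
  · intro a ha
    rcases List.mem_cons.1 ha with rfl | ha
    · exact List.mem_append_left _ w.bypass.end_mem_support
    · exact List.mem_append_right _ ha

theorem IsPathList.reverse {l : List V} (h : G.IsPathList l) : G.IsPathList l.reverse := by
  refine ⟨?_, List.nodup_reverse.2 h.2⟩
  rw [List.isChain_reverse]
  exact h.1.imp fun _ _ => Adj.symm

theorem covers_reverse {k : ℕ} {l : List V} {x : V} :
    G.Covers k l.reverse x ↔ G.Covers k l x := by
  simp [Covers]

theorem IsOptimal.reverse {k : ℕ} {l : List V} (h : G.IsOptimal k l) :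
    G.IsOptimal k l.reverse := by
  refine ⟨h.isPathList.reverse, fun l' hl' hsub x hx => ?_, fun l' hl' hsub => ?_⟩
  · exact covers_reverse.2 (h.covers_of_subset l' hl' (fun a ha => hsub (by simpa using ha)) x hx)
  · rw [List.length_reverse]
    exact h.length_le l' hl' fun x hx => hsub x (covers_reverse.2 hx)

/-- If the ends `p`, `e` of an optimal path `p, M₁, c, M₂, e` are joined outside the path, then no
walk that leaves the path from `c` and is disjoint from this detour reaches an uncovered vertex. -/
theorem IsOptimal.false_of_detour {k : ℕ} (hk : 1 ≤ k) {p c e : V} {M₁ M₂ : List V}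
    (h : G.IsOptimal k (p :: M₁ ++ c :: M₂ ++ [e])) {x : V}
    (hx : ¬ G.Covers k (p :: M₁ ++ c :: M₂ ++ [e]) x) {T : List V}
    (hT : G.IsPathList (T ++ [c])) (hxT : x ∈ T) (hTL : ∀ v ∈ T, v ∉ M₁ ++ c :: M₂)
    (R : G.Walk e p) (hR : ∀ v ∈ R.support, v ∉ M₁ ++ c :: M₂ ∧ v ∉ T) : False := by
  classical
  obtain ⟨hc, hn⟩ := h.isPathList
  set r := R.bypass.support with hr
  have hsub : ∀ v ∈ r, v ∈ R.support := fun v hv => R.support_bypass_subset_support hv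
  have hr0 : r ≠ [] := R.bypass.support_ne_nil
  have e1 : r = r.dropLast ++ [p] := by
    conv_lhs => rw [← List.dropLast_append_getLast hr0, R.bypass.getLast_support]
  have e2 : r = [e] ++ r.tail := R.bypass.cons_tail_support.symm
  have hrc : r.IsChain G.Adj := R.bypass.isChain_adj_support
  have hrn : r.Nodup := R.bypass_isPath.support_nodup
  have hce : (c :: M₂ ++ [e]).IsChain G.Adj := by
    rw [List.append_assoc] at hc
    exact hc.right_of_append
  have hpM : (p :: M₁).IsChain G.Adj := by
    rw [List.append_assoc] at hc
    exact hc.left_of_append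
  have c1 : (c :: M₂ ++ r).IsChain G.Adj := by
    rw [e2, ← List.append_assoc]
    exact hce.append_overlap (e2 ▸ hrc) (by simp)
  have c2 : (r ++ M₁).IsChain G.Adj := by
    rw [e1]
    exact List.IsChain.append_overlap (e1 ▸ hrc) hpM (by simp)
  have c3 : ([c] ++ (M₂ ++ r ++ M₁)).IsChain G.Adj := by
    simpa using c1.append_overlap c2 hr0
  have c4 := hT.1.append_overlap c3 (by simp)
  -- The new path comes in along `T` to `c`, follows `M₂` to `e`, takes the detour to `p` and ends
  -- with `M₁`: it contains the old path and `x`.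
  refine h.not_mem_of_subset hk hx (l := T ++ [c] ++ (M₂ ++ r ++ M₁)) ⟨c4, ?_⟩ ?_ (by simp [hxT])
  · have hTn := hT.2
    have hpr : ∀ v ∈ r, v ∉ M₁ ++ c :: M₂ ∧ v ∉ T := fun v hv => hR v (hsub v hv)
    clear_value r
    clear hc c1 c2 c3 c4 hce hpM e1 e2 hsub h hx hR
    simp only [List.nodup_append, List.nodup_cons, List.mem_append, List.mem_cons] at *
    grind
  · have hpr : p ∈ r := R.bypass.end_mem_support
    have her : e ∈ r := R.bypass.start_mem_support
    clear_value r
    intro v hv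
    simp only [List.mem_append, List.mem_cons] at *
    grind

/-! ### Three geodesics and the two induced subgraphs -/

/-- The configuration of three pairwise apart geodesics around an optimal path. -/
theorem exists_apart_geodesics [Finite V] (hG : G.Connected) {k : ℕ} (hk : 1 ≤ k)
    (hcov : ∀ l, G.IsPathList l → ∃ x, ¬ G.Covers k l x) :
    ∃ (p e : V) (M : List V) (y z c x : V) (A : G.Walk y p) (B : G.Walk z e) (Q : G.Walk c x),
      (p :: M ++ [e]).IsChain G.Adj ∧
      A.length = G.dist y p ∧ B.length = G.dist z e ∧ Q.length = G.dist c x ∧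
      k ≤ A.length + 1 ∧ k ≤ B.length + 1 ∧ k ≤ Q.length ∧
      (∀ r ∈ M, k ≤ G.dist y r ∧ k ≤ G.dist z r) ∧
      (∀ r ∈ p :: M ++ [e], ∀ j ≤ Q.length, j ≤ G.dist (Q.getVert j) r) ∧
      A.Apart B ∧ A.Apart Q.tail ∧ B.Apart Q.tail := by
  obtain ⟨L, hL⟩ := exists_isOptimal G k
  obtain ⟨x, hx⟩ := hcov L hL.isPathList
  have hx' : ∀ r ∈ L, k ≤ G.dist x r := by simpa [Covers] using hx
  obtain ⟨p, M, e, rfl⟩ : ∃ p M e, L = p :: M ++ [e] := by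
    rcases L with _ | ⟨p, L⟩
    · exact absurd (by simp) (hL.not_mem_of_subset hk hx (l := [x]) ⟨by simp, by simp⟩ (by simp))
    · rcases List.eq_nil_or_concat' L with rfl | ⟨M, e, rfl⟩
      · obtain ⟨w⟩ := hG.preconnected x p
        exact absurd (by simp) (hL.not_disjoint_of_cons hk hx w)
      · exact ⟨p, M, e, by simp⟩
  have hLr : G.IsOptimal k (e :: (M.reverse ++ [p])) := by simpa using hL.reverse
  have hxr : ¬ G.Covers k (e :: (M.reverse ++ [p])) x := by
    have := mt covers_reverse.1 hx
    simpa using this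
  obtain ⟨hc, hn⟩ := hL.isPathList
  obtain ⟨y, hyp, hyr⟩ := hL.exists_private (p := p) (l := M ++ [e])
    ⟨hc.tail, hn.of_cons⟩ (by simp) (by simp)
  obtain ⟨z, hze, hzr⟩ := hL.exists_private (p := e) (l := p :: M)
    ⟨hc.left_of_append, (List.nodup_append.1 hn).1⟩ (by simp; grind) (by simp)
  obtain ⟨c, hcL, hcmin⟩ := Set.exists_min_image {r | r ∈ p :: M ++ [e]} (G.dist x)
    (List.finite_toSet _) ⟨p, by simp⟩
  obtain ⟨A, hA⟩ := hG.exists_walk_length_eq_dist y p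
  obtain ⟨B, hB⟩ := hG.exists_walk_length_eq_dist z e
  obtain ⟨Q, hQ⟩ := hG.exists_walk_length_eq_dist c x
  have hQk : k ≤ Q.length := by
    rw [hQ, dist_comm]
    exact hx' c hcL
  have hQd : ∀ r ∈ p :: M ++ [e], ∀ j ≤ Q.length, j ≤ G.dist (Q.getVert j) r := by
    intro r hr j hj
    have h1 := hcmin r hr
    have h2 := hG.dist_triangle (u := x) (v := Q.getVert j) (w := r)
    have h3 := dist_le (Q.drop j).reverse
    rw [Walk.length_reverse, Walk.drop_length] at h3
    rw [dist_comm, ← hQ] at h1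
    omega
  have hQnil : ¬ Q.Nil := by
    rw [← Walk.length_eq_zero_iff]
    omega
  have hQs : Q.support = c :: Q.tail.support := (Q.cons_support_tail hQnil).symm
  have hQL : ∀ v ∈ Q.tail.support, v ∉ p :: M ++ [e] := by
    intro v hv hvL
    obtain ⟨j, rfl, hj⟩ := Walk.mem_support_iff_exists_getVert.1 hv
    rw [Walk.getVert_tail] at hvL
    have hl := Q.length_tail_add_one hQnil
    have := hQd _ hvL (j + 1) (by omega)
    rw [dist_self] at this
    omega
  have hAM : ∀ v ∈ A.support, v ∉ M ++ [e] := by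
    classical
    intro v hv hvM
    have h1 := hyr v hvM
    have h2 := dist_le (A.takeUntil v hv)
    have h3 := A.length_takeUntil_le_length hv
    omega
  have hBM : ∀ v ∈ B.support, v ∉ p :: M := by
    classical
    intro v hv hvM
    have h1 := hzr v hvM
    have h2 := dist_le (B.takeUntil v hv)
    have h3 := B.length_takeUntil_le_length hv
    omega
  -- The neighbour of `p` on the path is at distance at least `k` from `y`, so `p` is at distance at
  -- least `k - 1`.
  have hAk : k ≤ A.length + 1 := by
    obtain ⟨r, hr, hpr⟩ : ∃ r ∈ M ++ [e], G.Adj p r := by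
      rcases M with _ | ⟨r, M⟩
      · exact ⟨e, by simp, by simpa using hc⟩
      · simp only [List.cons_append, List.isChain_cons_cons] at hc
        exact ⟨r, by simp, hc.1⟩
    have h1 := hG.dist_triangle (u := y) (v := p) (w := r)
    rw [dist_eq_one_iff_adj.2 hpr] at h1
    have := hyr r hr
    omega
  have hBk : k ≤ B.length + 1 := by
    obtain ⟨r, hr, hpr⟩ : ∃ r ∈ p :: M, G.Adj e r := by
      have hc' := hLr.isPathList.1
      rcases h : M.reverse with _ | ⟨r, M'⟩
      · exact ⟨p, by simp, by simpa [h] using hc'⟩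
      · simp only [h, List.cons_append, List.isChain_cons_cons] at hc'
        have : r ∈ M.reverse := by simp [h]
        exact ⟨r, by simpa using Or.inr this, hc'.1⟩
    have h1 := hG.dist_triangle (u := z) (v := e) (w := r)
    rw [dist_eq_one_iff_adj.2 hpr] at h1
    have := hzr r hr
    omega
  have hAQ : A.Apart Q.tail := by
    suffices h : Q.tail.reverse.Apart A by
      intro u hu v hv
      have := h v (by rw [Walk.support_reverse]; exact List.mem_reverse.2 hv) u hu
      exact ⟨this.1.symm, fun hh => this.2 hh.symm⟩
    refine Walk.apart_of_forall_not_subset _ _ fun r hr => ?_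
    refine hL.not_disjoint_of_cons hk hx r fun v hv hvM => ?_
    rcases hr v hv with hv | hv
    · rw [Walk.support_reverse, List.mem_reverse] at hv
      exact hQL v hv (by simpa using Or.inr hvM)
    · exact hAM v hv hvM
  have hBQ : B.Apart Q.tail := by
    suffices h : Q.tail.reverse.Apart B by
      intro u hu v hv
      have := h v (by rw [Walk.support_reverse]; exact List.mem_reverse.2 hv) u hu
      exact ⟨this.1.symm, fun hh => this.2 hh.symm⟩
    refine Walk.apart_of_forall_not_subset _ _ fun r hr => ?_
    refine hLr.not_disjoint_of_cons hk hxr r fun v hv hvM => ?_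
    have hvM' : v ∈ p :: M := by simpa [or_comm] using hvM
    rcases hr v hv with hv | hv
    · rw [Walk.support_reverse, List.mem_reverse] at hv
      exact hQL v hv (List.mem_append_left _ hvM')
    · exact hBM v hv hvM'
  have hQr : ∀ v ∈ Q.reverse.support, v = c ∨ v ∈ Q.tail.support := by
    intro v hv
    rw [Walk.support_reverse, List.mem_reverse, hQs] at hv
    simpa using hv
  -- If `c` were an end, `Q` itself would prolong the path to `x`.
  have hcM : c ∈ M := by
    simp only [Set.mem_ofPred_eq, List.cons_append, List.mem_cons, List.mem_append,
      List.not_mem_nil, or_false] at hcL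
    rcases hcL with rfl | h | rfl
    · refine absurd (fun v hv hvM => ?_) (hL.not_disjoint_of_cons hk hx Q.reverse)
      rcases hQr v hv with rfl | hv
      · exact (List.nodup_cons.1 hn).1 hvM
      · exact hQL v hv (List.mem_cons_of_mem _ hvM)
    · exact h
    · refine absurd (fun v hv hvM => ?_) (hLr.not_disjoint_of_cons hk hxr Q.reverse)
      rcases hQr v hv with rfl | hv
      · exact (List.nodup_cons.1 hLr.isPathList.2).1 hvM
      · exact hQL v hv (by simp at hvM ⊢; tauto)
  -- A contact would give a walk from `e` to `p` inside `A ∪ B`, which is a forbidden detour.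
  have hBA : B.reverse.Apart A.reverse.reverse := by
    refine Walk.apart_of_forall_not_subset _ _ fun r hr => ?_
    obtain ⟨M₁, M₂, rfl⟩ := List.append_of_mem hcM
    refine IsOptimal.false_of_detour hk (T := Q.tail.support.reverse) (c := c) (R := r)
      (p := p) (e := e) (M₁ := M₁) (M₂ := M₂) (x := x) (by simpa using hL) (by simpa using hx)
      ⟨?_, ?_⟩ (by simp) ?_ ?_
    · have := Q.reverse.isChain_adj_support
      rwa [Walk.support_reverse, hQs, List.reverse_cons] at this
    · have := (Q.isPath_of_length_eq_dist hQ).support_nodup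
      rw [← List.nodup_reverse, hQs, List.reverse_cons] at this
      exact this
    · intro v hv hvM
      exact hQL v (by simpa using hv) (by simp at hvM ⊢; tauto)
    · intro v hv
      rw [List.mem_reverse]
      rcases hr v hv with hv | hv
      · rw [Walk.support_reverse, List.mem_reverse] at hv
        exact ⟨fun h => hBM v hv (List.mem_cons_of_mem _ h), fun h => (hBQ v hv v h).1 rfl⟩
      · rw [Walk.reverse_reverse] at hv
        exact ⟨fun h => hAM v hv (List.mem_append_left _ h), fun h => (hAQ v hv v h).1 rfl⟩
  refine ⟨p, e, M, y, z, c, x, A, B, Q, hc, hA, hB, hQ, hAk, hBk, hQk, fun r hr =>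
    ⟨hyr r (List.mem_append_left _ hr), hzr r (List.mem_cons_of_mem _ hr)⟩, hQd, ?_, hAQ, hBQ⟩
  intro u hu v hv
  have := hBA v (by simpa using hv) u (by simpa using hu)
  exact ⟨this.1.symm, fun hh => this.2 hh.symm⟩

theorem reachable_induce_of_isChain {s : Set V} {p e : V} {M : List V}
    (hc : (p :: M ++ [e]).IsChain G.Adj) (hs : ∀ v ∈ p :: M ++ [e], v ∈ s) (hp : p ∈ s)
    (he : e ∈ s) : (G.induce s).Reachable ⟨p, hp⟩ ⟨e, he⟩ := by
  induction M generalizing p with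
  | nil => exact Adj.reachable (by simpa using hc)
  | cons a M ih =>
    simp only [List.cons_append, List.isChain_cons_cons] at hc
    have ha : a ∈ s := hs a (by simp)
    have : (G.induce s).Adj ⟨p, hp⟩ ⟨a, ha⟩ := hc.1
    exact this.reachable.trans (ih hc.2 (fun v hv => hs v (List.mem_cons_of_mem _ hv)) ha)

theorem isIndContained_of_forall_not_covers [Finite V] (hG : G.Connected) {k : ℕ} (hk : 1 ≤ k)
    (hcov : ∀ l, G.IsPathList l → ∃ x, ¬ G.Covers k l x) :
    (pathGraph k ⊕g pathGraph k ⊕g pathGraph k).IsIndContained G ∧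
      (pathGraph (2 * k + 1) ⊕g pathGraph (k - 1)).IsIndContained G := by
  classical
  obtain ⟨p, e, M, y, z, c, x, A, B, Q, hc, hA, hB, hQ, hAk, hBk, hQk, hM, hQd, hAB, hAQ, hBQ⟩ :=
    exists_apart_geodesics hG hk hcov
  have htail : ∀ j, Q.getVert (1 + j) ∈ Q.tail.support := fun j => by
    rw [add_comm, ← Walk.getVert_tail]
    exact Walk.getVert_mem_support _ _
  constructor
  · obtain ⟨f, hf⟩ := A.exists_pathGraph_embedding hA (n := k) (s := 0) (by omega)
    obtain ⟨g, hg⟩ := B.exists_pathGraph_embedding hB (n := k) (s := 0) (by omega)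
    -- The shift by 1 drops `c`, which lies on the optimal path and may touch `A` or `B`.
    obtain ⟨h, hh⟩ := Q.exists_pathGraph_embedding hQ (n := k) (s := 1) (by omega)
    obtain ⟨fg, hf', hg'⟩ := exists_sum_embedding f g fun a b => by
      rw [hf, hg]
      exact hAB _ (A.getVert_mem_support _) _ (B.getVert_mem_support _)
    obtain ⟨fgh, -⟩ := exists_sum_embedding fg h fun a b => by
      rw [hh]
      rcases a with a | a
      · rw [hf', hf]
        exact hAQ _ (A.getVert_mem_support _) _ (htail _)
      · rw [hg', hg]
        exact hBQ _ (B.getVert_mem_support _) _ (htail _)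
    exact ⟨fgh⟩
  · set s : Set V := {v | v ∈ A.support ∨ v ∈ p :: M ++ [e] ∨ v ∈ B.support} with hs
    have hys : y ∈ s := .inl A.start_mem_support
    have hzs : z ∈ s := .inr (.inr B.start_mem_support)
    have hps : p ∈ s := .inl A.end_mem_support
    have hes : e ∈ s := .inr (.inr B.end_mem_support)
    have hreach : (G.induce s).Reachable ⟨y, hys⟩ ⟨z, hzs⟩ :=
      (A.induce s fun v hv => .inl hv).reachable.trans
        ((reachable_induce_of_isChain hc (fun v hv => .inr (.inl hv)) hps hes).trans
          (B.induce s fun v hv => .inr (.inr hv)).reachable.symm)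
    obtain ⟨W, hW⟩ := hreach.exists_walk_length_eq_dist
    -- Since `A` and `B` are apart, `W` leaves `A` into a vertex of `M`, at distance at least `k`
    -- from both `y` and `z`.
    have hlen : 2 * k ≤ W.length := by
      obtain ⟨d, hd, hd1, hd2⟩ := W.exists_boundary_dart {v | v.1 ∈ A.support}
        A.start_mem_support fun hz => (hAB z hz z B.start_mem_support).1 rfl
      have hdadj : G.Adj d.fst.1 d.snd.1 := d.adj
      have hnB : d.snd.1 ∉ B.support := fun h => (hAB _ hd1 _ h).2 hdadj
      have hdM : d.snd.1 ∈ M := by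
        rcases d.snd.2 with h | h | h
        · exact absurd h hd2
        · simp only [List.cons_append, List.mem_cons, List.mem_append, List.not_mem_nil,
            or_false] at h
          rcases h with h | h | h
          · exact absurd (show d.snd.1 ∈ A.support by rw [h]; exact A.end_mem_support) hd2
          · exact h
          · exact absurd (by rw [h]; exact B.end_mem_support) hnB
        · exact absurd h hnB
      have hdW := W.dart_snd_mem_support_of_mem_darts hd
      have h1 := dist_le ((W.takeUntil _ hdW).map (Embedding.induce s).toHom)
      have h2 := dist_le ((W.dropUntil _ hdW).map (Embedding.induce s).toHom).reverse
      have h3 := congrArg Walk.length (W.take_spec hdW)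
      rw [Walk.length_append] at h3
      rw [Walk.length_map] at h1
      rw [Walk.length_reverse, Walk.length_map] at h2
      have h4 := hM _ hdM
      have h5 := h4.1.trans h1
      have h6 := h4.2.trans h2
      omega
    obtain ⟨f, hf⟩ := W.exists_pathGraph_embedding hW (n := 2 * k + 1) (s := 0) (by omega)
    -- From index 2 on, `Q` is at distance at least 2 from the optimal path.
    obtain ⟨g, hg⟩ := Q.exists_pathGraph_embedding hQ (n := k - 1) (s := 2) (by omega)
    obtain ⟨fg, -⟩ := exists_sum_embedding ((Embedding.induce s).comp f) g fun a b => by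
      have hgb : g b ∈ Q.tail.support := by
        rw [hg, show 2 + (b : ℕ) = 1 + (1 + b) by omega]
        exact htail _
      rcases (f a).2 with h | h | h
      · exact hAQ _ h _ hgb
      · have h1 := hQd _ h (2 + b) (by omega)
        rw [← hg] at h1
        constructor
        · intro heq
          rw [← heq] at h1
          exact absurd h1 (by simp)
        · intro hadj
          have := dist_eq_one_iff_adj.2 hadj.symm
          change G.dist (g b) (f a).1 = 1 at this
          omega
      · exact hBQ _ h _ hgb
    exact ⟨fg⟩

theorem isIndContained_of_le_pathEccentricity [Finite V] (hG : G.Connected) {k : ℕ} (hk : 1 ≤ k)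
    (hpe : (k : ℕ∞) ≤ G.pathEccentricity) :
    (pathGraph k ⊕g pathGraph k ⊕g pathGraph k).IsIndContained G ∧
      (pathGraph (2 * k + 1) ⊕g pathGraph (k - 1)).IsIndContained G := by
  refine isIndContained_of_forall_not_covers hG hk fun l hl => ?_
  by_contra! hcov
  rcases eq_or_ne l [] with rfl | hne
  · obtain ⟨x⟩ := hG.nonempty
    simpa [Covers] using hcov x
  · refine hpe.not_gt ?_
    simp only [pathEccentricity, iInf_lt_iff]
    refine ⟨_, _, Walk.ofSupport l hne hl.1, ?_, ?_⟩
    · rw [Walk.isPath_def, Walk.support_ofSupport]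
      exact hl.2
    -- The uniform bound `k - 1` keeps the supremum strictly below `k`.
    · refine lt_of_le_of_lt (b := ((k - 1 : ℕ) : ℕ∞)) (iSup_le fun x => ?_)
        (by exact_mod_cast Nat.sub_lt hk one_pos)
      obtain ⟨y, hy, hxy⟩ := hcov x
      refine iInf₂_le_of_le y (by rwa [Walk.support_ofSupport]) ?_
      rw [← (hG.preconnected x y).coe_dist_eq_edist]
      exact_mod_cast Nat.le_sub_one_of_lt hxy

/-! ### Limbs, the spider and the net -/

/-- Three pairwise disjoint limbs of depth `k`, each attached at a single vertex, force path
eccentricity at least `k`; the number `h i x` is the depth of `x` in the limb `i`. -/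
theorem le_pathEccentricity_of_depth {k : ℕ} (h : Fin 3 → V → ℕ) (c : Fin 3 → V)
    (hadj : ∀ i u v, G.Adj u v → h i u ≤ h i v + 1)
    (hcut : ∀ i u v, G.Adj u v → h i u = 0 → 0 < h i v → u = c i)
    (hleaf : ∀ i, ∃ x, h i x = k)
    (hdisj : ∀ i j v, 0 < h i v → 0 < h j v → i = j) :
    (k : ℕ∞) ≤ G.pathEccentricity := by
  classical
  refine le_iInf fun u => le_iInf fun v => le_iInf fun p => le_iInf fun hp => ?_
  -- Two ends cannot lie in three disjoint limbs.
  obtain ⟨i, hu, hv⟩ : ∃ i, h i u = 0 ∧ h i v = 0 := by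
    by_contra! hcon
    have key : ∀ i, 0 < h i u ∨ 0 < h i v := fun i => by
      have := hcon i
      omega
    have h01 : (0 : Fin 3) ≠ 1 := by decide
    have h02 : (0 : Fin 3) ≠ 2 := by decide
    have h12 : (1 : Fin 3) ≠ 2 := by decide
    rcases key 0 with h0 | h0 <;> rcases key 1 with h1 | h1 <;> rcases key 2 with h2 | h2 <;>
      first
      | exact h01 (hdisj _ _ _ h0 h1)
      | exact h02 (hdisj _ _ _ h0 h2)
      | exact h12 (hdisj _ _ _ h1 h2)
  have cross : ∀ {a w : V} (q : G.Walk a w), h i a = 0 → h i w ≠ 0 →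
      c i ∈ q.support ∧ h i (c i) = 0 := by
    intro a w q ha hw
    obtain ⟨d, hd, hd1, hd2⟩ := q.exists_boundary_dart {x | h i x = 0} ha hw
    have := hcut i _ _ d.adj hd1 (Nat.pos_of_ne_zero hd2)
    rw [← this]
    exact ⟨q.dart_fst_mem_support_of_mem_darts hd, hd1⟩
  -- Entering and leaving the limb would both use `c i`, which a path visits only once.
  have havoid : ∀ w ∈ p.support, h i w = 0 := by
    intro w hw
    by_contra hne
    obtain ⟨h1, h0⟩ := cross (p.takeUntil w hw) hu hne
    obtain ⟨h2, -⟩ := cross (p.dropUntil w hw).reverse hv hne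
    rw [Walk.support_reverse, List.mem_reverse] at h2
    rw [← p.take_spec hw] at hp
    exact hp.ne_of_mem_support_of_append (fun hcw => hne (hcw ▸ h0)) h1 h2 rfl
  have hlip : ∀ {a b : V} (q : G.Walk a b), h i a ≤ h i b + q.length := by
    intro a b q
    induction q with
    | nil => simp
    | cons hab q ih =>
      have := hadj i _ _ hab
      rw [Walk.length_cons]
      omega
  obtain ⟨x, hx⟩ := hleaf i
  refine le_iSup_of_le x (le_iInf₂ fun y hy => le_iInf fun q => ?_)
  have := hlip q
  rw [havoid y hy, hx, zero_add] at this
  exact_mod_cast this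

/-- The spider: three paths on `k` vertices and a further vertex, adjacent to an end of each. -/
def spider (k : ℕ) : SimpleGraph (Option (Fin 3 × Fin k)) where
  Adj
    | none, none => False
    | none, some b => b.2.val = 0
    | some a, none => a.2.val = 0
    | some a, some b => a.1 = b.1 ∧ (a.2.val + 1 = b.2.val ∨ b.2.val + 1 = a.2.val)
  symm := ⟨by
    rintro (_ | a) (_ | b) h
    · exact h
    · exact h
    · exact h
    · exact ⟨h.1.symm, h.2.symm⟩⟩
  loopless := ⟨by
    rintro (_ | a) h
    · exact h
    · rcases h.2 with h | h <;> omega⟩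

/-- The net: a triangle with a path on `k` further vertices attached to each of its vertices. -/
def net (k : ℕ) : SimpleGraph (Fin 3 × Fin (k + 1)) where
  Adj a b := (a.1 = b.1 ∧ (a.2.val + 1 = b.2.val ∨ b.2.val + 1 = a.2.val)) ∨
    (a.1 ≠ b.1 ∧ a.2.val = 0 ∧ b.2.val = 0)
  symm := ⟨fun a b h => by
    rcases h with ⟨h, h'⟩ | ⟨h, h'⟩
    · exact .inl ⟨h.symm, h'.symm⟩
    · exact .inr ⟨h.symm, h'.symm⟩⟩
  loopless := ⟨fun a h => by
    rcases h with ⟨-, h⟩ | ⟨h, -⟩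
    · omega
    · exact h rfl⟩

theorem spider_connected (k : ℕ) : (spider k).Connected := by
  have key : ∀ (n : ℕ) (i : Fin 3) (hn : n < k),
      (spider k).Reachable none (some (i, ⟨n, hn⟩)) := by
    intro n i
    induction n with
    | zero => exact fun hn => Adj.reachable (show (spider k).Adj none (some (i, ⟨0, hn⟩)) from rfl)
    | succ n ih =>
      intro hn
      refine (ih (by omega)).trans (Adj.reachable ?_)
      exact ⟨rfl, .inl rfl⟩
  refine connected_iff_exists_forall_reachable _ |>.2 ⟨none, ?_⟩
  rintro (_ | ⟨i, n, hn⟩)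
  · exact .rfl
  · exact key n i hn

theorem net_connected (k : ℕ) : (net k).Connected := by
  have key : ∀ (n : ℕ) (i : Fin 3) (hn : n < k + 1),
      (net k).Reachable (0, 0) (i, ⟨n, hn⟩) := by
    intro n i
    induction n with
    | zero =>
      intro hn
      by_cases hi : 0 = i
      · subst hi
        exact .rfl
      · exact Adj.reachable (.inr ⟨hi, rfl, rfl⟩)
    | succ n ih =>
      intro hn
      exact (ih (by omega)).trans (Adj.reachable (.inl ⟨rfl, .inl rfl⟩))
  refine connected_iff_exists_forall_reachable _ |>.2 ⟨(0, 0), ?_⟩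
  rintro ⟨i, n, hn⟩
  exact key n i hn

/-- In the net, among any three neighbours of a vertex two are equal or adjacent. -/
theorem net_claw_free {k : ℕ} {v : Fin 3 × Fin (k + 1)} {f : Fin 3 → Fin 3 × Fin (k + 1)}
    (hf : Function.Injective f) (hv : ∀ i, (net k).Adj v (f i))
    (hn : ∀ i j, ¬ (net k).Adj (f i) (f j)) : False := by
  have h01 := hf.ne (show (0 : Fin 3) ≠ 1 by decide)
  have h02 := hf.ne (show (0 : Fin 3) ≠ 2 by decide)
  have h12 := hf.ne (show (1 : Fin 3) ≠ 2 by decide)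
  have n01 := hn 0 1
  have n02 := hn 0 2
  have n12 := hn 1 2
  have v0 := hv 0
  have v1 := hv 1
  have v2 := hv 2
  simp only [net, ne_eq, Prod.ext_iff, Fin.ext_iff] at *
  omega

/-- If the connected graphs with path eccentricity at least `k` all contain `H`, then so does every
connected graph with three limbs of depth `k`. -/
theorem isIndContained_of_depth {W : Type u} {H : SimpleGraph W} {k : ℕ}
    (hH : ∀ (V : Type v) [Finite V] (G : SimpleGraph V),
      G.Connected → IsIndFree H G → G.pathEccentricity < (k : ℕ∞))
    {X : Type} [Finite X] {G : SimpleGraph X} (hG : G.Connected)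
    (h : Fin 3 → X → ℕ) (c : Fin 3 → X)
    (hadj : ∀ i u v, G.Adj u v → h i u ≤ h i v + 1)
    (hcut : ∀ i u v, G.Adj u v → h i u = 0 → 0 < h i v → u = c i)
    (hleaf : ∀ i, ∃ x, h i x = k)
    (hdisj : ∀ i j v, 0 < h i v → 0 < h j v → i = j) : H.IsIndContained G := by
  -- The example lives in `Type`; lifting moves it to the universe of `hH`.
  let e := Iso.comap (Equiv.ulift.{v} (α := X)) G
  by_contra hfree
  refine (hH (ULift.{v} X) (G.comap Equiv.ulift) (e.connected_iff.2 hG)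
    fun hc => hfree (hc.trans ⟨e.toEmbedding⟩)).not_ge ?_
  refine le_pathEccentricity_of_depth (fun i x => h i x.down) (fun i => ⟨c i⟩)
    (fun i u v huv => hadj i _ _ huv) (fun i u v huv hu hv => ?_) (fun i => ?_)
    (fun i j v => hdisj i j _)
  · exact congrArg ULift.up (hcut i _ _ huv hu hv)
  · obtain ⟨x, hx⟩ := hleaf i
    exact ⟨⟨x⟩, hx⟩

/-- The depth of a vertex of the spider in the leg `i`. -/
def spiderDepth (k : ℕ) (i : Fin 3) : Option (Fin 3 × Fin k) → ℕ
  | none => 0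
  | some a => if a.1 = i then a.2.val + 1 else 0

theorem isIndContained_spider {W : Type u} {H : SimpleGraph W} {k : ℕ} (hk : 1 ≤ k)
    (hH : ∀ (V : Type v) [Finite V] (G : SimpleGraph V),
      G.Connected → IsIndFree H G → G.pathEccentricity < (k : ℕ∞)) :
    H.IsIndContained (spider k) := by
  refine isIndContained_of_depth hH (spider_connected k) (spiderDepth k) (fun _ => none)
    ?_ ?_ ?_ ?_
  · rintro i (_ | a) (_ | b) h <;> simp only [spider, spiderDepth] at * <;>
      split_ifs <;> omega
  · rintro i (_ | a) (_ | b) h <;> simp only [spider, spiderDepth] at * <;> grind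
  · exact fun i => ⟨some (i, ⟨k - 1, by omega⟩), by simp [spiderDepth]; omega⟩
  · rintro i j (_ | a) <;> simp only [spiderDepth] <;> grind

theorem isIndContained_net {W : Type u} {H : SimpleGraph W} {k : ℕ}
    (hH : ∀ (V : Type v) [Finite V] (G : SimpleGraph V),
      G.Connected → IsIndFree H G → G.pathEccentricity < (k : ℕ∞)) :
    H.IsIndContained (net k) := by
  refine isIndContained_of_depth hH (net_connected k)
    (fun i a => if a.1 = i then a.2.val else 0) (fun i => (i, 0)) ?_ ?_ ?_ ?_
  · rintro i a b h
    simp only [net] at *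
    split_ifs <;> omega
  · rintro i ⟨a, s⟩ ⟨b, t⟩ h
    simp only [net] at *
    simp only [Prod.ext_iff, Fin.ext_iff, Fin.val_zero]
    split_ifs <;> omega
  · exact fun i => ⟨(i, Fin.last k), by simp⟩
  · rintro i j a
    grind

/-! ### Induced subgraphs of the spider -/

theorem IsIndContained.of_range_subset {W T : Type*} {H : SimpleGraph W} {K : SimpleGraph T}
    (f : H ↪g G) (g : K ↪g G) (h : ∀ w, ∃ t, g t = f w) : H.IsIndContained K := by
  choose t ht using h
  refine ⟨⟨⟨t, fun a b hab => f.injective ?_⟩, fun {a b} => ?_⟩⟩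
  · rw [← ht a, ← ht b, hab]
  · rw [← f.map_adj_iff, ← ht a, ← ht b, g.map_adj_iff]
    rfl

theorem exists_embedding_of_adj_iff {T : Type*} {K : SimpleGraph T} (g : T → V)
    (hg : Function.Injective g) (h : ∀ a b, G.Adj (g a) (g b) ↔ K.Adj a b) :
    ∃ f : K ↪g G, ∀ t, f t = g t :=
  ⟨⟨⟨g, hg⟩, fun {a b} => h a b⟩, fun _ => rfl⟩

/-- The spider without its centre. -/
theorem exists_embedding_spider_centre (k : ℕ) :
    ∃ g : (pathGraph k ⊕g pathGraph k ⊕g pathGraph k) ↪g spider k,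
      ∀ a, ∃ t, g t = some a := by
  let g : (Fin k ⊕ Fin k) ⊕ Fin k → Option (Fin 3 × Fin k)
    | .inl (.inl j) => some (0, j)
    | .inl (.inr j) => some (1, j)
    | .inr j => some (2, j)
  obtain ⟨f, hf⟩ := exists_embedding_of_adj_iff (G := spider k)
    (K := pathGraph k ⊕g pathGraph k ⊕g pathGraph k) g
    (by
      rintro ((a | a) | a) ((b | b) | b) hab <;> simp [g] at hab ⊢
      all_goals exact hab)
    (by
      rintro ((a | a) | a) ((b | b) | b) <;> simp [g, spider, pathGraph_adj])
  refine ⟨f, ?_⟩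
  rintro ⟨i, j⟩
  simp only [hf]
  fin_cases i
  · exact ⟨.inl (.inl j), rfl⟩
  · exact ⟨.inl (.inr j), rfl⟩
  · exact ⟨.inr j, rfl⟩

/-- The spider without a neighbour of its centre. -/
theorem exists_embedding_spider_leg {k : ℕ} (i : Fin 3) :
    ∃ g : (pathGraph (2 * k + 1) ⊕g pathGraph (k - 1)) ↪g spider k,
      ∀ x, (∀ j : Fin k, j.val = 0 → x ≠ some (i, j)) → ∃ t, g t = x := by
  -- The long path runs inwards along leg `i + 1`, through the centre at index `k`, and outwards
  -- along leg `i + 2`; the short one is leg `i` without its first vertex.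
  let g : Fin (2 * k + 1) ⊕ Fin (k - 1) → Option (Fin 3 × Fin k)
    | .inl t => if h : t.val < k then some (i + 1, ⟨k - 1 - t, by omega⟩)
        else if h' : t.val = k then none else some (i + 2, ⟨t - (k + 1), by omega⟩)
    | .inr t => some (i, ⟨t + 1, by omega⟩)
  have e1 : i ≠ i + 1 := by revert i; decide
  have e2 : i ≠ i + 2 := by revert i; decide
  have e3 : i + 1 ≠ i + 2 := by revert i; decide
  have e4 : ∀ j, j = i ∨ j = i + 1 ∨ j = i + 2 := by clear e1 e2 e3 g; revert i; decide
  obtain ⟨f, hf⟩ := exists_embedding_of_adj_iff (G := spider k)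
    (K := pathGraph (2 * k + 1) ⊕g pathGraph (k - 1)) g
    (by
      rintro (a | a) (b | b) hab <;> simp only [g] at hab
      · split_ifs at hab <;> simp [e3, e3.symm] at hab <;> simp [Fin.ext_iff] <;> omega
      · split_ifs at hab <;> simp [e1.symm, e2.symm] at hab
      · split_ifs at hab <;> simp [e1, e2] at hab
      · simp at hab
        simp [Fin.ext_iff]; omega)
    (by
      rintro (a | a) (b | b)
      · simp only [sum_adj_inl, pathGraph_adj, g]
        split_ifs <;> simp [spider, e3, e3.symm] <;> omega
      · simp only [g]
        split_ifs <;> simp [spider, e1.symm, e2.symm]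
      · simp only [g]
        split_ifs <;> simp [spider, e1, e2]
      · simp [g, spider, pathGraph_adj])
  refine ⟨f, ?_⟩
  simp only [hf]
  rintro (_ | ⟨j, s⟩) hx
  · exact ⟨.inl ⟨k, by omega⟩, by simp [g]⟩
  · rcases e4 j with h | rfl | rfl
    · have hs : s.val ≠ 0 := fun hs => hx s hs (by rw [h])
      refine ⟨.inr ⟨s - 1, by omega⟩, ?_⟩
      simp only [g, h, Option.some.injEq, Prod.mk.injEq, true_and, Fin.ext_iff]
      omega
    · refine ⟨.inl ⟨k - 1 - s, by omega⟩, ?_⟩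
      have h1 : k - 1 - s.val < k := by omega
      simp only [g, h1, dif_pos, Option.some.injEq, Prod.mk.injEq, true_and, Fin.ext_iff]
      omega
    · refine ⟨.inl ⟨k + 1 + s, by omega⟩, ?_⟩
      have h1 : ¬ k + 1 + s.val < k := by omega
      have h2 : ¬ k + 1 + s.val = k := by omega
      simp only [g, h1, h2, dif_neg, not_false_eq_true, Option.some.injEq, Prod.mk.injEq,
        true_and, Fin.ext_iff]
      omega

end SimpleGraph

/-! ### The equivalence -/

theorem corollary6 {W : Type u} [Finite W] (H : SimpleGraph W) (k : ℕ) (hk : 1 ≤ k) :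
    (∀ (V : Type v) [Finite V] (G : SimpleGraph V),
        G.Connected → SimpleGraph.IsIndFree H G → G.pathEccentricity < (k : ℕ∞)) ↔
      (H.IsIndContained
          (SimpleGraph.pathGraph k ⊕g SimpleGraph.pathGraph k ⊕g SimpleGraph.pathGraph k) ∨
        H.IsIndContained
          (SimpleGraph.pathGraph (2 * k + 1) ⊕g SimpleGraph.pathGraph (k - 1))) := by
  constructor
  · intro hH
    obtain ⟨f⟩ := SimpleGraph.isIndContained_spider hk hH
    obtain ⟨g⟩ := SimpleGraph.isIndContained_net hH
    by_cases hc : ∃ w, f w = none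
    · obtain ⟨w, hw⟩ := hc
      right
      -- Otherwise `H` contains the claw formed by the centre and its three neighbours, which `g`
      -- would carry into the net.
      obtain ⟨i, hi⟩ : ∃ i : Fin 3, ∀ a, f a ≠ some (i, ⟨0, hk⟩) := by
        by_contra! hcon
        choose a ha using hcon
        refine SimpleGraph.net_claw_free (v := g w) (f := fun i => g (a i)) ?_ ?_ ?_
        · intro i j hij
          have := ha i
          rw [g.injective hij, ha j] at this
          simpa using this.symm
        · intro i
          rw [g.map_adj_iff, ← f.map_adj_iff, hw, ha i]
          rfl
        · intro i j
          rw [g.map_adj_iff, ← f.map_adj_iff, ha i, ha j]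
          simp [SimpleGraph.spider]
      obtain ⟨g', hg'⟩ := SimpleGraph.exists_embedding_spider_leg (k := k) i
      refine .of_range_subset f g' fun a => hg' _ fun j hj hja => hi a ?_
      rw [hja, show j = ⟨0, hk⟩ from Fin.ext hj]
    · left
      push Not at hc
      obtain ⟨g', hg'⟩ := SimpleGraph.exists_embedding_spider_centre k
      refine .of_range_subset f g' fun a => ?_
      obtain ⟨b, hb⟩ := Option.ne_none_iff_exists'.1 (hc a)
      rw [hb]
      exact hg' b
  · intro hH V _ G hG hfree
    by_contra hpe
    obtain ⟨h1, h2⟩ := SimpleGraph.isIndContained_of_le_pathEccentricity hG hk (not_lt.1 hpe)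
    exact hfree (hH.elim (·.trans h1) (·.trans h2))
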